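/- **Setting.** A (finite-dimensional probabilistic) *model* $A$ consists of a finite-dimensional ordered real vector space $\mathbf{E}(A)$ with positive cone $\mathbf{E}(A)_+$ and an order unit $u_A\in \mathbf{E}(A)_+$ (for each $a\ge 0$ there is $t>0$ with $ta\le u_A$); a family $\mathfrak{A}(A)$ of *tests*, each a finite non-empty subset of $\mathbf{E}(A)_+$ with sum $u_A$, such that the set $X(A)=\bigcup\mathfrak{A}(A)$ of *outcomes* generates the cone $\mathbf{E}(A)_+$; and a semigroup $\mathcal{D}(A)$ (under composition) of positive linear maps $\tau:\mathbf{E}(A)\to \mathbf{E}(A)$ with $\tau(u_A)\le u_A$, called *processes*. A *state* is a positive linear functional $\alpha$ on $\mathbf{E}(A)$ with $\alpha(u_A)=1$. A process is *reversible* if it is invertible and its inverse is a positive multiple of a process; $\mathcal{G}(A)$ is the group of positive multiples of reversible processes. An inner product $\langle\cdot,\cdot\rangle$ on $\mathbf{E}(A)$ is *self-dualizing* if $\mathbf{E}(A)_+=\{a : \langle a,b\rangle\ge 0 \text{ for all } b\in \mathbf{E}(A)_+\}$. The model $A$ is *HSD* if $\mathcal{G}(A)$ acts transitively on the interior of $\mathbf{E}(A)_+$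 and a self-dualizing inner product exists. By the Koecher–Vinberg theorem, if $A$ is HSD then $\mathbf{E}(A)$ has a unique Euclidean (i.e. formally real) Jordan product $\bullet$ with identity $u_A$ and cone of squares $\mathbf{E}(A)_+$. A non-zero $p\in\mathbf{E}(A)_+$ with $p\bullet p=p$ is an *idempotent*; it is *primitive* if it is not the sum of two distinct idempotents. A *Jordan frame* is a finite set of primitive idempotents with sum $u_A$. The *trace* of $a\in\mathbf{E}(A)$ is $\operatorname{tr}(a)=\sum_i\lambda_i$ for any spectral decomposition $a=\sum_i\lambda_i e_i$ along a Jordan frame $\{e_1,\dots,e_n\}$, and the *trace form* is $\langle a,b\rangle_A=\operatorname{tr}(a\bullet b)$. A *Jordan model* is an HSD model all of whose outcomes are primitive idempotents. A *non-signaling composite* of models $A$ and $B$ is a model $AB$ with bilinear maps $\otimes:\mathbf{E}(A)\times\mathbf{E}(B)\to\mathbf{E}(AB)$ and $\otimes:\mathbf{E}(A)^*\times\mathbf{E}(B)^*\to\mathbf{E}(AB)^*$ such that 1. for all tests $S\in\mathfrak{A}(A)$, $T\in\mathfrak{A}(B)$, the set $\{x\otimes y : x\in S,\ y\in T\}$ is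 a test of $AB$; 2. $(\alpha\otimes\beta)(x\otimes y)=\alpha(x)\beta(y)$ for all states $\alpha$ of $A$ and $\beta$ of $B$ and all outcomes $x\in X(A)$, $y\in X(B)$; 3. for all $\tau_A\in\mathcal{D}(A)$, $\tau_B\in\mathcal{D}(B)$ there is a process $\tau\in\mathcal{D}(AB)$ with $(\alpha\otimes\beta)\circ\tau=(\alpha\circ\tau_A)\otimes(\beta\circ\tau_B)$ for all $\alpha\in\mathbf{E}(A)^*$, $\beta\in\mathbf{E}(B)^*$. The composite $AB$ is *factorizably self-dual* if there are self-dualizing inner products on $\mathbf{E}(A)$, $\mathbf{E}(B)$ and $\mathbf{E}(AB)$ with $\langle a\otimes b,c\otimes d\rangle=\langle a,c\rangle\langle b,d\rangle$ for all $a,c\in\mathbf{E}(A)$ and $b,d\in\mathbf{E}(B)$. **Lemma.** Let $A$ and $B$ be Jordan models and let $AB$ be a non-signaling composite of $A$ and $B$ that is itself a Jordan model. Then the trace form on $\mathbf{E}(AB)$ factors: $$\langle a\otimes b,\ c\otimes d\rangle_{AB}=\langle a,c\rangle_A\,\langle b,d\rangle_B\qquad\text{for all } a,c\in\mathbf{E}(A),\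 b,d\in\mathbf{E}(B),$$ where the three trace forms are self-dualizing inner products on $\mathbf{E}(A)$, $\mathbf{E}(B)$ and $\mathbf{E}(AB)$. In particular $AB$ is factorizably self-dual. -/

import Mathlib

section ProbabilisticModels

variable (E : Type*) [AddCommGroup E] [Module ℝ E] [PartialOrder E]

/-- A probabilistic model on the ordered real vector space `E` (with cone `{a | 0 ≤ a}`): an order
unit, a test space of observables whose outcomes generate the cone, and a semigroup of processes.
Finite-dimensionality of `E` and compatibility of its order with the vector space structure are
supplied as instances where the model is used. -/
structure ProbModel where
  /-- the order unit -/
  unit : E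
  unit_nonneg : 0 ≤ unit
  exists_smul_le_unit : ∀ a : E, 0 ≤ a → ∃ t : ℝ, 0 < t ∧ t • a ≤ unit
  /-- the tests; each is a non-empty set of effects that sum to the order unit -/
  tests : Set (Finset E)
  test_nonempty : ∀ T ∈ tests, T.Nonempty
  test_nonneg : ∀ T ∈ tests, ∀ x ∈ T, 0 ≤ x
  test_sum : ∀ T ∈ tests, ∑ x ∈ T, x = unit
  /-- the outcomes generate the positive cone -/
  nonneg_mem_span : ∀ a : E, 0 ≤ a →
    a ∈ Submodule.span {t : ℝ // 0 ≤ t} {x : E | ∃ T ∈ tests, x ∈ T}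
  /-- the processes -/
  processes : Subsemigroup (Module.End ℝ E)
  process_nonneg : ∀ τ ∈ processes, ∀ a : E, 0 ≤ a → 0 ≤ τ a
  process_unit_le : ∀ τ ∈ processes, τ unit ≤ unit

end ProbabilisticModels

namespace ProbModel

section Basic

variable {E : Type*} [AddCommGroup E] [Module ℝ E] [PartialOrder E] (A : ProbModel E)

/-- The outcome set: the union of all tests. -/
def outcomes : Set E := {x | ∃ T ∈ A.tests, x ∈ T}

/-- A state: a normalized positive linear functional. -/
def IsState (α : Module.Dual ℝ E) : Prop :=
  (∀ a : E, 0 ≤ a → 0 ≤ α a) ∧ α A.unit = 1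

/-- A process is reversible if it is invertible and its inverse is a positive multiple of a
process (in particular the inverse is positive). -/
def IsReversible (τ : Module.End ℝ E) : Prop :=
  τ ∈ A.processes ∧
    ∃ σ ∈ A.processes, ∃ c : ℝ, 0 < c ∧ τ * (c • σ) = 1 ∧ (c • σ) * τ = 1

/-- The group generated by the reversible processes: their positive multiples. -/
def reversibleGroup : Set (Module.End ℝ E) :=
  {g | ∃ c : ℝ, 0 < c ∧ ∃ τ, A.IsReversible τ ∧ g = c • τ}

/-- The cone is homogeneous: the group of reversible processes acts transitively on its
interior. -/
def IsHomogeneous [TopologicalSpace E] : Prop :=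
  ∀ a ∈ interior {x : E | 0 ≤ x}, ∀ b ∈ interior {x : E | 0 ≤ x},
    ∃ g ∈ A.reversibleGroup, g a = b

end Basic

end ProbModel

/-- `f` is an inner product on `E` for which the positive cone of `E` is its own dual cone. -/
structure IsSelfDualizing {E : Type*} [AddCommGroup E] [Module ℝ E] [PartialOrder E]
    (f : E → E → ℝ) : Prop where
  add_left : ∀ a b c : E, f (a + b) c = f a c + f b c
  smul_left : ∀ (t : ℝ) (a b : E), f (t • a) b = t * f a b
  symm : ∀ a b : E, f a b = f b a
  pos : ∀ a : E, a ≠ 0 → 0 < f a a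
  self_dual : ∀ a : E, 0 ≤ a ↔ ∀ b : E, 0 ≤ b → 0 ≤ f a b

namespace ProbModel

section Jordan

variable {E : Type*} [AddCommGroup E] [Module ℝ E] [PartialOrder E] (A : ProbModel E)

/-- Homogeneous and self-dual models. -/
def IsHSD [TopologicalSpace E] : Prop :=
  A.IsHomogeneous ∧ ∃ f : E → E → ℝ, IsSelfDualizing f

/-- `m` is a formally real (equivalently, in finite dimension, Euclidean) Jordan product whose
identity is the order unit and whose cone of squares is the positive cone. -/
structure IsEuclideanJordanProduct (m : E →ₗ[ℝ] E →ₗ[ℝ] E) : Prop where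
  comm : ∀ a b : E, m a b = m b a
  jordan : ∀ a b : E, m (m a a) (m a b) = m a (m (m a a) b)
  unit_mul : ∀ a : E, m A.unit a = a
  formally_real : ∀ a b : E, m a a + m b b = 0 → a = 0 ∧ b = 0
  nonneg_iff_square : ∀ a : E, 0 ≤ a ↔ ∃ b : E, m b b = a

open Classical in
/-- The Euclidean Jordan product of the model. For an HSD model there is exactly one, by the
Koecher-Vinberg theorem. The value `0` is used only if there is none; for that value no element
is an idempotent in the sense below. -/
noncomputable def jordanProduct : E →ₗ[ℝ] E →ₗ[ℝ] E :=
  if h : ∃ m : E →ₗ[ℝ] E →ₗ[ℝ] E, A.IsEuclideanJordanProduct m then h.choose else 0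

/-- Idempotents; they are non-zero by convention. -/
def IsIdempotent (p : E) : Prop :=
  p ≠ 0 ∧ 0 ≤ p ∧ A.jordanProduct p p = p

/-- Primitive idempotents: those that are not the sum of two distinct (non-zero) idempotents. -/
def IsPrimitiveIdempotent (e : E) : Prop :=
  A.IsIdempotent e ∧
    ¬ ∃ p q : E, p ≠ q ∧ A.IsIdempotent p ∧ A.IsIdempotent q ∧ e = p + q

/-- Jordan frames: sets of primitive idempotents summing to the unit. -/
def IsJordanFrame (s : Finset E) : Prop :=
  (∀ e ∈ s, A.IsPrimitiveIdempotent e) ∧ ∑ e ∈ s, e = A.unit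

/-- Jordan models: HSD models in which every outcome is a primitive idempotent. -/
def IsJordanModel [TopologicalSpace E] : Prop :=
  A.IsHSD ∧ ∀ x ∈ A.outcomes, A.IsPrimitiveIdempotent x

/-- `(s, c)` is a spectral decomposition `a = ∑ e ∈ s, c e • e` along a Jordan frame `s`. -/
def IsSpectralDecomposition (a : E) (d : Finset E × (E → ℝ)) : Prop :=
  A.IsJordanFrame d.1 ∧ a = ∑ e ∈ d.1, d.2 e • e

open Classical in
/-- The Jordan trace: the sum of the eigenvalues in a spectral decomposition. By the spectral
theorem every element of a Euclidean Jordan algebra has one, and the sum does not depend on it. In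
particular a primitive idempotent has trace one. -/
noncomputable def jordanTrace (a : E) : ℝ :=
  if h : ∃ d : Finset E × (E → ℝ), A.IsSpectralDecomposition a d then
    ∑ e ∈ h.choose.1, h.choose.2 e
  else 0

/-- The trace form `⟨a, b⟩ = tr (a • b)`. -/
noncomputable def traceForm (a b : E) : ℝ := A.jordanTrace (A.jordanProduct a b)

end Jordan

end ProbModel

section Composites

variable {E F G : Type*} [AddCommGroup E] [Module ℝ E] [PartialOrder E]
  [AddCommGroup F] [Module ℝ F] [PartialOrder F] [AddCommGroup G] [Module ℝ G] [PartialOrder G]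

open Classical in
/-- The data and laws that make the model `AB` a non-signaling composite of the models `A` and `B`.
A process `τ` acts on functionals by `ω ↦ ω ∘ τ`. -/
structure NonSignalingComposite (A : ProbModel E) (B : ProbModel F) (AB : ProbModel G) where
  /-- product effects `a ⊗ b` -/
  tensor : E →ₗ[ℝ] F →ₗ[ℝ] G
  /-- product functionals `α ⊗ β` -/
  dualTensor : Module.Dual ℝ E →ₗ[ℝ] Module.Dual ℝ F →ₗ[ℝ] Module.Dual ℝ G
  product_test : ∀ S ∈ A.tests, ∀ T ∈ B.tests,
    Finset.image₂ (fun x y => tensor x y) S T ∈ AB.tests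
  product_apply : ∀ α β, A.IsState α → B.IsState β → ∀ x ∈ A.outcomes, ∀ y ∈ B.outcomes,
    dualTensor α β (tensor x y) = α x * β y
  product_process : ∀ τA ∈ A.processes, ∀ τB ∈ B.processes, ∃ τ ∈ AB.processes,
    ∀ (α : Module.Dual ℝ E) (β : Module.Dual ℝ F),
      (dualTensor α β).comp τ = dualTensor (α.comp τA) (β.comp τB)

namespace NonSignalingComposite

variable {A : ProbModel E} {B : ProbModel F} {AB : ProbModel G}

/-- The form `h` on the composite factors into the self-dualizing inner products `f` and `g`:
`⟨a ⊗ b, c ⊗ d⟩ = ⟨a, c⟩ ⟨b, d⟩`. -/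
def Factors (C : NonSignalingComposite A B AB)
    (f : E → E → ℝ) (g : F → F → ℝ) (h : G → G → ℝ) : Prop :=
  IsSelfDualizing f ∧ IsSelfDualizing g ∧
    ∀ (a c : E) (b d : F), h (C.tensor a b) (C.tensor c d) = f a c * g b d

/-- The self-dualizing inner product on the composite can be chosen to factor. -/
def IsFactorizablySelfDual (C : NonSignalingComposite A B AB) : Prop :=
  ∃ (f : E → E → ℝ) (g : F → F → ℝ) (h : G → G → ℝ), IsSelfDualizing h ∧ C.Factors f g h

end NonSignalingComposite

end Composites

/-! Fix outcomes x, y and put ω(a, b) = ⟨x ⊗ y, a ⊗ b⟩ in the trace form of AB. Since x ⊗ y is again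
an outcome, hence a primitive idempotent, ω is positive with ω(x, y) = ω(u, u) = 1, and monotonicity
gives ω(u, y) = ω(x, u) = 1. In a Jordan model ⟨y, ·⟩ is the only state with value one at the
outcome y (`IsPureForm.apply_eq`), so the marginal ω(u, ·) is ⟨y, ·⟩. For an outcome b, ω(u - x, b)
lies between 0 and ω(u - x, u) = 0; by the same uniqueness, up to scale, ω(·, b) = ω(u, b)⟨x, ·⟩ =
⟨y, b⟩⟨x, ·⟩. This is the usual argument that a joint state with a pure marginal is a product.
Outcomes span, so the identity extends bilinearly (`form_tensor`).

The uniqueness needs a trace form that is self-dualizing and satisfies ⟨v, v⟩ ≤ ⟨v, u⟩² on the cone.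
This is derived from the Jordan identity. Formal reality makes the algebra generated by one element
split over ℝ, which gives the spectral theorem and, after refinement, frames of primitive
idempotents (`exists_frame`). For primitive e the Peirce projection is P(e)y = α(y)e with a
functional α = `transition m e`; the fundamental formula makes these numbers symmetric in two
primitives (`transition_symm`), so summing them over a frame yields a linear trace. Peirce
components then give positivity of tr(ef), hence self-duality. -/

/-- `m` is a formally real Jordan product with identity `u`. -/
structure IsFormallyRealJordan {E : Type*} [AddCommGroup E] [Module ℝ E]
    (m : E →ₗ[ℝ] E →ₗ[ℝ] E) (u : E) : Prop where
  comm : ∀ a b : E, m a b = m b a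
  jordan : ∀ a b : E, m (m a a) (m a b) = m a (m (m a a) b)
  unit_mul : ∀ a : E, m u a = a
  formally_real : ∀ a b : E, m a a + m b b = 0 → a = 0 ∧ b = 0

namespace IsFormallyRealJordan

open Polynomial

variable {E : Type*} [AddCommGroup E] [Module ℝ E] {m : E →ₗ[ℝ] E →ₗ[ℝ] E} {u : E}

/-! ### Peirce decomposition for an idempotent -/

section Peirce

theorem mul_unit (H : IsFormallyRealJordan m u) (a : E) : m a u = a := by
  rw [H.comm, H.unit_mul]

/-- Full polarization of the Jordan identity in its cubic variable; the six orderings of x, y, z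
coincide in pairs, whence the factor 1/2 in the proof. -/
theorem linearized (H : IsFormallyRealJordan m u) (x y z w : E) :
    m x (m (m y z) w) + m y (m (m x z) w) + m z (m (m x y) w)
      = m (m y z) (m x w) + m (m x z) (m y w) + m (m x y) (m z w) := by
  have h1 := H.jordan (x + y + z) w
  have h2 := H.jordan (x + y) w
  have h3 := H.jordan (x + z) w
  have h4 := H.jordan (y + z) w
  have h5 := H.jordan x w
  have h6 := H.jordan y w
  have h7 := H.jordan z w
  simp only [map_add, LinearMap.add_apply, H.comm y x, H.comm z x, H.comm z y] at h1 h2 h3 h4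
  linear_combination (norm := module) (-(1 / 2 : ℝ)) • (h1 - h2 - h3 - h4 + h5 + h6 + h7)

/-- The right side of `linearized` is symmetric under exchanging x and w, so the two left sides
agree. The result writes multiplication by a triple product through multiplications by shorter ones.
-/
theorem mul_mul_mul_apply (H : IsFormallyRealJordan m u) (x y z w : E) :
    m (m x (m y z)) w = m x (m (m y z) w) + m y (m (m x z) w) + m z (m (m x y) w)
      - m y (m x (m z w)) - m z (m x (m y w)) := by
  have h1 := H.linearized x y z w
  have h2 := H.linearized w y z x
  rw [H.comm w z, H.comm w y, H.comm w x, H.comm y x, H.comm z x, H.comm (m z w) (m x y),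
    H.comm (m y w) (m x z)] at h2
  rw [H.comm (m x (m y z)) w, H.comm x (m y z), H.comm x (m z w), H.comm x (m y w)]
  linear_combination (norm := module) h2 - h1

theorem idem_commutator (H : IsFormallyRealJordan m u) {e : E} (he : m e e = e) (y w : E) :
    (2 : ℝ) • (m e (m (m e y) w) - m (m e y) (m e w)) = m e (m y w) - m y (m e w) := by
  have h := H.linearized e e y w
  rw [he] at h
  linear_combination (norm := module) h

/-- Multiplication by an element of the Peirce spaces `0` and `1` of `e` commutes with
multiplication by `e`. -/
theorem idem_mul_comm (H : IsFormallyRealJordan m u) {e : E} (he : m e e = e) {y : E} {i : ℝ}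
    (hy : m e y = i • y) (hi : 2 * i - 1 ≠ 0) (w : E) : m e (m y w) = m y (m e w) := by
  have h := H.idem_commutator he y w
  simp only [hy, map_smul, LinearMap.smul_apply] at h
  have h' : (2 * i - 1) • (m e (m y w) - m y (m e w)) = 0 := by
    linear_combination (norm := module) h
  exact sub_eq_zero.1 ((smul_eq_zero.1 h').resolve_left hi)

/-- Multiplication L by e satisfies L(2L - 1)(L - 1) = 0. The three Peirce projections are the
Lagrange interpolation polynomials in L at the roots 1, 1/2, 0. -/
theorem idem_cubic (H : IsFormallyRealJordan m u) {e : E} (he : m e e = e) (y : E) :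
    (2 : ℝ) • m e (m e (m e y)) = (3 : ℝ) • m e (m e y) - m e y := by
  have h := H.mul_mul_mul_apply e e e y
  rw [he, he] at h
  linear_combination (norm := module) h

theorem one_mul_one (H : IsFormallyRealJordan m u) {e : E} (he : m e e = e) {y z : E}
    (hy : m e y = y) (hz : m e z = z) : m e (m y z) = m y z := by
  rw [H.idem_mul_comm he (i := 1) (by simpa using hy) (by norm_num), hz]

theorem zero_mul_zero (H : IsFormallyRealJordan m u) {e : E} (he : m e e = e) {y z : E}
    (hy : m e y = 0) (hz : m e z = 0) : m e (m y z) = 0 := by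
  rw [H.idem_mul_comm he (i := 0) (by simpa using hy) (by norm_num), hz, map_zero]

/-- Computing e(yz) by commuting L(e) past L(y) gives 0, past L(z) gives yz. -/
theorem one_mul_zero (H : IsFormallyRealJordan m u) {e : E} (he : m e e = e) {y z : E}
    (hy : m e y = y) (hz : m e z = 0) : m y z = 0 := by
  have h1 := H.idem_mul_comm he (i := 1) (y := y) (by simpa using hy) (by norm_num) z
  have h2 := H.idem_mul_comm he (i := 0) (y := z) (by simpa using hz) (by norm_num) y
  rw [hz, map_zero] at h1
  rw [hy, H.comm z y, h1] at h2
  exact h2.symm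

theorem one_mul_half (H : IsFormallyRealJordan m u) {e : E} (he : m e e = e) {y z : E}
    (hy : m e y = y) (hz : m e z = (1 / 2 : ℝ) • z) : m e (m y z) = (1 / 2 : ℝ) • m y z := by
  rw [H.idem_mul_comm he (i := 1) (by simpa using hy) (by norm_num), hz, map_smul]

theorem zero_mul_half (H : IsFormallyRealJordan m u) {e : E} (he : m e e = e) {y z : E}
    (hy : m e y = 0) (hz : m e z = (1 / 2 : ℝ) • z) : m e (m y z) = (1 / 2 : ℝ) • m y z := by
  rw [H.idem_mul_comm he (i := 0) (by simpa using hy) (by norm_num), hz, map_smul]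

end Peirce

end IsFormallyRealJordan

/-- The projection onto the Peirce space `1` of `e`. -/
def peirceOne {E : Type*} [AddCommGroup E] [Module ℝ E] (m : E →ₗ[ℝ] E →ₗ[ℝ] E) (e : E) :
    E →ₗ[ℝ] E :=
  (2 : ℝ) • (m e ∘ₗ m e) - m e

/-- The projection onto the Peirce space `1 / 2` of `e`. -/
def peirceHalf {E : Type*} [AddCommGroup E] [Module ℝ E] (m : E →ₗ[ℝ] E →ₗ[ℝ] E) (e : E) :
    E →ₗ[ℝ] E :=
  (4 : ℝ) • (m e - m e ∘ₗ m e)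

/-- The projection onto the Peirce space `0` of `e`. -/
def peirceZero {E : Type*} [AddCommGroup E] [Module ℝ E] (m : E →ₗ[ℝ] E →ₗ[ℝ] E) (e : E) :
    E →ₗ[ℝ] E :=
  LinearMap.id - (3 : ℝ) • m e + (2 : ℝ) • (m e ∘ₗ m e)

namespace IsFormallyRealJordan

open Polynomial

variable {E : Type*} [AddCommGroup E] [Module ℝ E] {m : E →ₗ[ℝ] E →ₗ[ℝ] E} {u : E}

section Peirce

theorem peirceOne_apply (e y : E) : peirceOne m e y = (2 : ℝ) • m e (m e y) - m e y := rfl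

theorem peirceHalf_apply (e y : E) : peirceHalf m e y = (4 : ℝ) • (m e y - m e (m e y)) := rfl

theorem peirceZero_apply (e y : E) :
    peirceZero m e y = y - (3 : ℝ) • m e y + (2 : ℝ) • m e (m e y) := rfl

theorem peirce_sum (e y : E) : peirceOne m e y + peirceHalf m e y + peirceZero m e y = y := by
  rw [peirceOne_apply, peirceHalf_apply, peirceZero_apply]
  module

theorem mul_peirceOne (H : IsFormallyRealJordan m u) {e : E} (he : m e e = e) (y : E) :
    m e (peirceOne m e y) = peirceOne m e y := by
  have h := H.idem_cubic he y
  simp only [peirceOne_apply, map_sub, map_smul]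
  linear_combination (norm := module) h

theorem mul_peirceHalf (H : IsFormallyRealJordan m u) {e : E} (he : m e e = e) (y : E) :
    m e (peirceHalf m e y) = (1 / 2 : ℝ) • peirceHalf m e y := by
  have h := H.idem_cubic he y
  simp only [peirceHalf_apply, map_sub, map_smul]
  linear_combination (norm := module) (-2 : ℝ) • h

theorem mul_peirceZero (H : IsFormallyRealJordan m u) {e : E} (he : m e e = e) (y : E) :
    m e (peirceZero m e y) = 0 := by
  have h := H.idem_cubic he y
  simp only [peirceZero_apply, map_sub, map_add, map_smul]
  linear_combination (norm := module) h

theorem peirceOne_of_one {e y : E} (hy : m e y = y) : peirceOne m e y = y := by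
  rw [peirceOne_apply, hy, hy]; module

theorem peirceOne_of_half {e y : E} (hy : m e y = (1 / 2 : ℝ) • y) : peirceOne m e y = 0 := by
  rw [peirceOne_apply, hy, map_smul, hy]; module

theorem peirceOne_of_zero {e y : E} (hy : m e y = 0) : peirceOne m e y = 0 := by
  rw [peirceOne_apply, hy, map_zero]; module

/-- The case `P(e) P(y) e = (P(e) y)²` of the fundamental formula. -/
theorem peirceOne_quadratic (H : IsFormallyRealJordan m u) {e : E} (he : m e e = e) (y : E) :
    peirceOne m e ((2 : ℝ) • m y (m y e) - m (m y y) e)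
      = m (peirceOne m e y) (peirceOne m e y) := by
  obtain ⟨y₁, h, y₀, h1, h2, h3, rfl⟩ : ∃ y₁ h y₀, m e y₁ = y₁ ∧ m e h = (1 / 2 : ℝ) • h ∧
      m e y₀ = 0 ∧ y = y₁ + h + y₀ :=
    ⟨_, _, _, H.mul_peirceOne he y, H.mul_peirceHalf he y, H.mul_peirceZero he y,
      (peirce_sum e y).symm⟩
  have a1 : peirceOne m e (m y₁ y₁) = m y₁ y₁ := peirceOne_of_one (H.one_mul_one he h1 h1)
  have a2 : peirceOne m e (m y₁ h) = 0 := peirceOne_of_half (H.one_mul_half he h1 h2)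
  have a3 : m y₁ y₀ = 0 := H.one_mul_zero he h1 h3
  have a4 : peirceOne m e (m y₀ h) = 0 := peirceOne_of_half (H.zero_mul_half he h3 h2)
  have a5 : peirceOne m e (m y₀ y₀) = 0 := peirceOne_of_zero (H.zero_mul_zero he h3 h3)
  -- P(e) absorbs multiplication by e. Of the products of Peirce components only y₁² and h² then
  -- survive, and the two contributions of h² cancel.
  have key : ∀ z, peirceOne m e (m z e) = peirceOne m e z := by
    intro z
    rw [H.comm]
    have h := H.idem_cubic he z
    simp only [peirceOne_apply]
    linear_combination (norm := module) h
  have hye : m (y₁ + h + y₀) e = y₁ + (1 / 2 : ℝ) • h := by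
    rw [H.comm, map_add, map_add, h1, h2, h3, add_zero]
  have hl : peirceOne m e (y₁ + h + y₀) = y₁ := by
    rw [map_add, map_add, peirceOne_of_one h1, peirceOne_of_half h2, peirceOne_of_zero h3]
    simp
  rw [map_sub, key, hye, hl]
  simp only [map_add, map_smul, LinearMap.add_apply, H.comm h y₁, H.comm y₀ y₁, H.comm h y₀,
    a1, a2, a3, a4, a5, map_zero]
  module

end Peirce

/-! ### Power associativity and polynomial calculus -/

section Powers

/-- Two-step induction: `mul_mul_mul_apply` expresses L(a(ac)) through L(a), L(ac), L(c) and L(a²).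
The last of these is why commutation with L(a²) is carried along. -/
theorem commute_mul_pow (H : IsFormallyRealJordan m u) (a : E) (n : ℕ) :
    Commute (m (((m a : Module.End ℝ E) ^ n) u) : Module.End ℝ E) (m a) ∧
      Commute (m (((m a : Module.End ℝ E) ^ n) u) : Module.End ℝ E) (m (m a a)) := by
  have haa : Commute (m a : Module.End ℝ E) (m (m a a)) :=
    LinearMap.ext fun b => (H.jordan a b).symm
  induction n using Nat.twoStepInduction with
  | zero =>
    have : (m u : Module.End ℝ E) = 1 := LinearMap.ext fun b => H.unit_mul b
    simp [this]
  | one => simpa [H.mul_unit] using haa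
  | more n h1 h2 =>
    set c := ((m a : Module.End ℝ E) ^ n) u with hc
    have hc1 : ((m a : Module.End ℝ E) ^ (n + 1)) u = m a c := by rw [pow_succ']; rfl
    have hc2 : ((m a : Module.End ℝ E) ^ (n + 2)) u = m a (m a c) := by
      rw [pow_succ']; exact congrArg _ hc1
    have key : (m (m a (m a c)) : Module.End ℝ E) = (m a * m (m a c) + m a * m (m a c)
        + m c * m (m a a) - m a * (m a * m c) - m c * (m a * m a) : Module.End ℝ E) :=
      LinearMap.ext fun w => H.mul_mul_mul_apply a a c w
    rw [hc1] at h2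
    rw [hc2, key]
    have ha := Commute.refl (m a : Module.End ℝ E)
    have hb := Commute.refl (m (m a a) : Module.End ℝ E)
    refine ⟨?_, ?_⟩
    · exact ((((ha.mul_left h2.1).add_left (ha.mul_left h2.1)).add_left
        (h1.1.mul_left haa.symm)).sub_left (ha.mul_left (ha.mul_left h1.1))).sub_left
        (h1.1.mul_left (ha.mul_left ha))
    · exact ((((haa.mul_left h2.2).add_left (haa.mul_left h2.2)).add_left
        (h1.2.mul_left hb)).sub_left (haa.mul_left (haa.mul_left h1.2))).sub_left
        (h1.2.mul_left (haa.mul_left haa))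

end Powers

end IsFormallyRealJordan

/-- The value `p(a)` of a polynomial at an element of a Jordan algebra with product `m` and
identity `u`. -/
noncomputable def jordanEval {E : Type*} [AddCommGroup E] [Module ℝ E]
    (m : E →ₗ[ℝ] E →ₗ[ℝ] E) (u a : E) : Polynomial ℝ →ₗ[ℝ] E :=
  LinearMap.applyₗ u ∘ₗ (Polynomial.aeval (m a : Module.End ℝ E)).toLinearMap

namespace IsFormallyRealJordan

open Polynomial

variable {E : Type*} [AddCommGroup E] [Module ℝ E] {m : E →ₗ[ℝ] E →ₗ[ℝ] E} {u : E}

section Powers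

theorem jordanEval_apply (a : E) (p : ℝ[X]) :
    jordanEval m u a p = aeval (m a : Module.End ℝ E) p u := rfl

theorem jordanEval_one (a : E) : jordanEval m u a 1 = u := by simp [jordanEval_apply]

theorem jordanEval_X (H : IsFormallyRealJordan m u) (a : E) : jordanEval m u a X = a := by
  simp [jordanEval_apply, H.mul_unit]

theorem jordanEval_X_mul (a : E) (p : ℝ[X]) :
    jordanEval m u a (X * p) = m a (jordanEval m u a p) := by
  simp [jordanEval_apply]

theorem commute_mul_jordanEval (H : IsFormallyRealJordan m u) (a : E) (p : ℝ[X]) :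
    Commute (m (jordanEval m u a p) : Module.End ℝ E) (m a) := by
  induction p using Polynomial.induction_on' with
  | add p q hp hq => rw [map_add, map_add]; exact hp.add_left hq
  | monomial n c =>
    have : jordanEval m u a (monomial n c) = c • ((m a : Module.End ℝ E) ^ n) u := by
      simp [jordanEval_apply, aeval_monomial, Algebra.algebraMap_eq_smul_one]
    rw [this, map_smul]
    exact (H.commute_mul_pow a n).1.smul_left c

theorem jordanEval_mul (H : IsFormallyRealJordan m u) (a : E) (p q : ℝ[X]) :
    jordanEval m u a (p * q) = m (jordanEval m u a p) (jordanEval m u a q) := by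
  have h : Commute (m (jordanEval m u a p) : Module.End ℝ E) (aeval (m a : Module.End ℝ E) q) := by
    induction q using Polynomial.induction_on' with
    | add q r hq hr => rw [map_add]; exact hq.add_right hr
    | monomial n c =>
      rw [aeval_monomial]
      exact (Algebra.commute_algebraMap_right c _).mul_right ((H.commute_mul_jordanEval a p).pow_right n)
  have h' := LinearMap.congr_fun h.eq u
  simp only [Module.End.mul_apply, H.mul_unit] at h'
  rw [jordanEval_apply a q, h', mul_comm, jordanEval_apply, map_mul]
  rfl

end Powers

end IsFormallyRealJordan

namespace IsFormallyRealJordan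

open Polynomial

variable {E : Type*} [AddCommGroup E] [Module ℝ E] {m : E →ₗ[ℝ] E →ₗ[ℝ] E} {u : E}

/-! ### Spectral theorem -/

section Spectral

/-- The annihilating polynomials of `a` are those that vanish on a finite set of reals. -/
theorem exists_finset_jordanEval_eq_zero_iff [FiniteDimensional ℝ E]
    (H : IsFormallyRealJordan m u) (a : E) :
    ∃ s : Finset ℝ, ∀ p : ℝ[X], jordanEval m u a p = 0 ↔ ∀ x ∈ s, p.eval x = 0 := by
  classical
  let I : Ideal ℝ[X] :=
    { carrier := {p | jordanEval m u a p = 0}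
      add_mem' := fun {p q} (hp : _ = _) (hq : _ = _) => by
        change jordanEval m u a (p + q) = 0
        rw [map_add, hp, hq, add_zero]
      zero_mem' := map_zero (jordanEval m u a)
      smul_mem' := fun q p (hp : _ = _) => by
        change jordanEval m u a (q * p) = 0
        rw [H.jordanEval_mul, hp, map_zero] }
  have hI : ∀ p, p ∈ I ↔ jordanEval m u a p = 0 := fun p => Iff.rfl
  obtain ⟨f, hf⟩ : ∃ f, I = Ideal.span {f} := (IsPrincipalIdealRing.principal I).principal
  have hfd : ∀ p, jordanEval m u a p = 0 ↔ f ∣ p := fun p => by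
    rw [← hI, hf, Ideal.mem_span_singleton]
  have hf0 : f ≠ 0 := by
    rintro rfl
    have h1 := (hfd (minpoly ℝ (m a : Module.End ℝ E))).1 (by simp [jordanEval_apply])
    exact minpoly.ne_zero (Algebra.IsIntegral.isIntegral _) (zero_dvd_iff.1 h1)
  -- Formal reality, read in ℝ[X] modulo the generator f of the annihilator.
  have hsq : ∀ p q : ℝ[X], f ∣ p * p + q * q → f ∣ q := fun p q h => by
    rw [← hfd, map_add, H.jordanEval_mul, H.jordanEval_mul] at h
    exact (hfd q).1 (H.formally_real _ _ h).2
  have hroot : ∀ p, f ∣ p → ∀ x ∈ f.roots.toFinset, p.eval x = 0 := fun p hp x hx => by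
    rw [Multiset.mem_toFinset, mem_roots hf0] at hx
    exact hx.dvd hp
  refine ⟨f.roots.toFinset, fun p => ⟨fun h => hroot p ((hfd p).1 h), fun h => ?_⟩⟩
  obtain ⟨g, hg, -, hgr⟩ := f.exists_prod_multiset_X_sub_C_mul
  have hg0 : g ≠ 0 := by rintro rfl; exact hf0 (by rw [← hg, mul_zero])
  -- A non-real root z would give f = ((X - re z)² + (im z)²)k. Then f divides the sum of the
  -- squares of (X - re z)k and (im z)k, hence divides k, which has smaller degree.
  have hgu : IsUnit g := by
    rw [isUnit_iff_degree_eq_zero]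
    by_contra hd
    obtain ⟨z, hz⟩ := IsAlgClosed.exists_root (g.map (algebraMap ℝ ℂ)) (by rwa [degree_map])
    have hz' : aeval z g = 0 := by rwa [IsRoot, eval_map_algebraMap] at hz
    have him : z.im ≠ 0 := by
      intro h0
      have hzr : z = algebraMap ℝ ℂ z.re := Complex.ext (by simp) (by simp [h0])
      rw [hzr, aeval_algebraMap_apply] at hz'
      have : z.re ∈ g.roots := by
        rw [mem_roots hg0, IsRoot]
        simpa using hz'
      simp [hgr] at this
    have hdvd : X ^ 2 - C (2 * z.re) * X + C (‖z‖ ^ 2) ∣ f :=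
      (g.quadratic_dvd_of_aeval_eq_zero_im_ne_zero hz' him).trans ⟨_, by rw [mul_comm, hg]⟩
    obtain ⟨k, hk⟩ := hdvd
    have hq : (X ^ 2 - C (2 * z.re) * X + C (‖z‖ ^ 2) : ℝ[X])
        = (X - C z.re) * (X - C z.re) + C z.im * C z.im := by
      rw [Complex.sq_norm, Complex.normSq_apply]
      simp only [map_add, map_mul, map_ofNat]
      ring
    have h1 : f ∣ C z.im * k := by
      refine hsq ((X - C z.re) * k) _ ⟨k, ?_⟩
      rw [hk, hq]
      ring
    have h2 : f ∣ k := ((isUnit_C.2 (isUnit_iff_ne_zero.2 him)).dvd_mul_left).1 h1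
    have hk0 : k ≠ 0 := by rintro rfl; exact hf0 (by rw [hk, mul_zero])
    have h3 := degree_le_of_dvd h2 hk0
    have h4 : natDegree (X ^ 2 - C (2 * z.re) * X + C (‖z‖ ^ 2) : ℝ[X]) = 2 := by
      compute_degree!
    have h5 : (X ^ 2 - C (2 * z.re) * X + C (‖z‖ ^ 2) : ℝ[X]) ≠ 0 := by
      intro h0; rw [h0] at h4; simp at h4
    have h6 := natDegree_le_natDegree h3
    rw [hk, natDegree_mul h5 hk0, h4] at h6
    omega
  have hpow : ∀ t : Multiset ℝ, (∀ x ∈ t, p.eval x = 0) →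
      (t.map fun x => X - C x).prod ∣ p ^ Multiset.card t := by
    intro t
    induction t using Multiset.induction_on with
    | empty => simp
    | cons x t ih =>
      intro hx
      rw [Multiset.map_cons, Multiset.prod_cons, Multiset.card_cons, pow_succ']
      exact mul_dvd_mul (dvd_iff_isRoot.2 (hx x (Multiset.mem_cons_self x t)))
        (ih fun y hy => hx y (Multiset.mem_cons_of_mem hy))
  have hfp : f ∣ p ^ Multiset.card f.roots := by
    rw [← hg]
    refine (hgu.mul_right_dvd).2 ?_
    rw [hg]
    exact hpow _ fun x hx => h x (Multiset.mem_toFinset.2 hx)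
  -- The ideal is radical: `hsq` with first square zero halves the exponent, rounding up, until it
  -- is at most one.
  have hrad : ∀ n, f ∣ p ^ n → f ∣ p := by
    intro n
    induction n using Nat.strong_induction_on with
    | _ n ih =>
      intro hn
      rcases Nat.lt_or_ge n 2 with h2 | h2
      · exact hn.trans (by interval_cases n <;> simp)
      · refine ih ((n + 1) / 2) (by omega) (hsq 0 _ ?_)
        rw [zero_mul, zero_add, ← pow_add]
        exact hn.trans (pow_dvd_pow _ (by omega))
  exact (hfd p).2 (hrad _ hfp)

/-- The spectral theorem. The spectral idempotents of non-zero eigenvalues lie in every subspace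
that contains `a` and is stable under multiplication by `a`. -/
theorem exists_spectral [FiniteDimensional ℝ E] (H : IsFormallyRealJordan m u) (a : E) :
    ∃ (s : Finset ℝ) (e : ℝ → E), (∀ x ∈ s, e x ≠ 0 ∧ m (e x) (e x) = e x) ∧
      (∀ x ∈ s, ∀ y ∈ s, x ≠ y → m (e x) (e y) = 0) ∧ ∑ x ∈ s, e x = u ∧
      ∑ x ∈ s, x • e x = a ∧
      ∀ W : Submodule ℝ E, a ∈ W → (∀ b ∈ W, m a b ∈ W) → ∀ x ∈ s, x ≠ 0 → e x ∈ W := by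
  classical
  obtain ⟨s, hs⟩ := H.exists_finset_jordanEval_eq_zero_iff a
  have heq : ∀ p q : ℝ[X], (∀ x ∈ s, p.eval x = q.eval x) →
      jordanEval m u a p = jordanEval m u a q := fun p q h => by
    rw [← sub_eq_zero, ← map_sub, hs]
    intro x hx
    rw [eval_sub, h x hx, sub_self]
  have hinj : Set.InjOn (id : ℝ → ℝ) s := Function.injective_id.injOn
  have hself : ∀ x ∈ s, (Lagrange.basis s id x).eval x = 1 := fun x hx =>
    Lagrange.eval_basis_self hinj hx
  have hne : ∀ x, ∀ y ∈ s, x ≠ y → (Lagrange.basis s id x).eval y = 0 := fun x y hy hxy =>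
    Lagrange.eval_basis_of_ne (v := id) hxy hy
  -- The spectral idempotents are the Lagrange basis polynomials of the spectrum, evaluated at a.
  refine ⟨s, fun x => jordanEval m u a (Lagrange.basis s id x), fun x hx => ⟨fun h => ?_, ?_⟩,
    fun x hx y hy hxy => ?_, ?_, ?_, fun W ha hW x hx hx0 => ?_⟩
  · have := (hs _).1 h x hx
    rw [hself x hx] at this
    exact one_ne_zero this
  · rw [← H.jordanEval_mul]
    refine heq _ _ fun y hy => ?_
    rcases eq_or_ne x y with rfl | hxy
    · rw [eval_mul, hself x hy, one_mul]
    · rw [eval_mul, hne x y hy hxy, zero_mul]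
  · rw [← H.jordanEval_mul, ← map_zero (jordanEval m u a)]
    refine heq _ _ fun z hz => ?_
    rcases eq_or_ne x z with rfl | hxz
    · rw [eval_mul, hne y x hz hxy.symm, mul_zero, eval_zero]
    · rw [eval_mul, hne x z hz hxz, zero_mul, eval_zero]
  · rw [← map_sum]
    refine Eq.trans ?_ (jordanEval_one (m := m) (u := u) a)
    refine heq _ _ fun y hy => ?_
    rw [eval_finsetSum, Finset.sum_eq_single_of_mem y hy fun x _ hxy => hne x y hy hxy,
      hself y hy, eval_one]
  · simp only [← map_smul]
    rw [← map_sum]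
    nth_rw 2 [← H.jordanEval_X a]
    refine heq _ _ fun y hy => ?_
    rw [eval_finsetSum, Finset.sum_eq_single_of_mem y hy fun x _ hxy => by
      rw [eval_smul, hne x y hy hxy, smul_zero], eval_smul, hself y hy, eval_X, smul_eq_mul,
      mul_one]
  · have hXW : ∀ p : ℝ[X], jordanEval m u a (X * p) ∈ W := by
      intro p
      induction p using Polynomial.induction_on with
      | C c =>
        rw [mul_comm, ← smul_eq_C_mul, map_smul, H.jordanEval_X]
        exact W.smul_mem c ha
      | add p q hp hq => rw [mul_add, map_add]; exact W.add_mem hp hq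
      | monomial n c ih =>
        have : X * (C c * X ^ (n + 1)) = X * (X * (C c * X ^ n)) := by ring
        rw [this, jordanEval_X_mul]
        exact hW _ ih
    -- On the spectrum, the basis polynomial at x ≠ 0 agrees with x⁻¹X times itself, which has no
    -- constant term.
    have h := W.smul_mem x⁻¹ (hXW (Lagrange.basis s id x))
    rw [heq (X * Lagrange.basis s id x) (x • Lagrange.basis s id x) fun y hy => ?_, map_smul,
      inv_smul_smul₀ hx0] at h
    · exact h
    · rcases eq_or_ne x y with rfl | hxy
      · simp
      · simp [hne x y hy hxy]

end Spectral

end IsFormallyRealJordan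

/-! ### Primitive idempotents and frames -/

/-- A primitive idempotent for the product `m`. -/
structure IsPrimitive {E : Type*} [AddCommGroup E] [Module ℝ E]
    (m : E →ₗ[ℝ] E →ₗ[ℝ] E) (e : E) : Prop where
  ne_zero : e ≠ 0
  idem : m e e = e
  indecomposable : ∀ p q : E, p ≠ 0 → m p p = p → q ≠ 0 → m q q = q → e ≠ p + q

/-- A finite set of non-zero pairwise orthogonal idempotents with sum `u`. -/
structure IsOrthogonalSystem {E : Type*} [AddCommGroup E] [Module ℝ E]
    (m : E →ₗ[ℝ] E →ₗ[ℝ] E) (u : E) (s : Finset E) : Prop where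
  ne_zero : ∀ e ∈ s, e ≠ 0
  idem : ∀ e ∈ s, m e e = e
  orthogonal : ∀ e ∈ s, ∀ f ∈ s, e ≠ f → m e f = 0
  sum_eq : ∑ e ∈ s, e = u

namespace IsOrthogonalSystem

variable {E : Type*} [AddCommGroup E] [Module ℝ E] {m : E →ₗ[ℝ] E →ₗ[ℝ] E} {u : E}
  {s : Finset E}

theorem mul_sum (hs : IsOrthogonalSystem m u s) (c : E → ℝ) {e : E} (he : e ∈ s) :
    m e (∑ f ∈ s, c f • f) = c e • e := by
  rw [map_sum, Finset.sum_eq_single_of_mem e he, map_smul, hs.idem e he]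
  intro f hf hfe
  rw [map_smul, hs.orthogonal e he f hf hfe.symm, smul_zero]

theorem card_le [FiniteDimensional ℝ E] (hs : IsOrthogonalSystem m u s) :
    s.card ≤ Module.finrank ℝ E := by
  classical
  have : LinearIndependent ℝ (fun e : s => (e : E)) := by
    rw [Fintype.linearIndependent_iff]
    intro c hc e
    have h : ∑ f ∈ s, (fun x => if h : x ∈ s then c ⟨x, h⟩ else 0) f • f = 0 := by
      rw [← Finset.sum_coe_sort, ← hc]
      exact Finset.sum_congr rfl fun f _ => by simp
    have h1 := hs.mul_sum (fun x => if h : x ∈ s then c ⟨x, h⟩ else 0) e.2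
    rw [h, map_zero] at h1
    have h2 := (smul_eq_zero.1 h1.symm).resolve_right (hs.ne_zero e e.2)
    simpa using h2
  exact this.finset_card_le_finrank

end IsOrthogonalSystem

namespace IsFormallyRealJordan

variable {E : Type*} [AddCommGroup E] [Module ℝ E] {m : E →ₗ[ℝ] E →ₗ[ℝ] E} {u : E}

section Frames

theorem mul_eq_zero_of_idem_add (H : IsFormallyRealJordan m u) {p q : E} (hp : m p p = p)
    (hq : m q q = q) (hpq : m (p + q) (p + q) = p + q) : m p q = 0 := by
  simp only [map_add, LinearMap.add_apply, hp, hq, H.comm q p] at hpq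
  have : (2 : ℝ) • m p q = 0 := by linear_combination (norm := module) hpq
  exact (smul_eq_zero.1 this).resolve_left two_ne_zero

/-- Every element is a combination of pairwise orthogonal primitive idempotents. -/
theorem exists_frame [FiniteDimensional ℝ E] (H : IsFormallyRealJordan m u) (a : E) :
    ∃ (s : Finset E) (c : E → ℝ), IsOrthogonalSystem m u s ∧ (∀ e ∈ s, IsPrimitive m e) ∧
      a = ∑ e ∈ s, c e • e := by
  classical
  let N : Set ℕ := {n | ∃ s : Finset E, IsOrthogonalSystem m u s ∧
    a ∈ Submodule.span ℝ (s : Set E) ∧ s.card = n}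
  have hbdd : BddAbove N := ⟨Module.finrank ℝ E, by rintro n ⟨s, hs, -, rfl⟩; exact hs.card_le⟩
  have hne : N.Nonempty := by
    obtain ⟨s, e, h1, h2, h3, h4, -⟩ := H.exists_spectral a
    have hinj : ∀ x ∈ s, ∀ y ∈ s, e x = e y → x = y := by
      intro x hx y hy hxy
      by_contra hne
      have := h2 x hx y hy hne
      rw [← hxy, (h1 x hx).2] at this
      exact (h1 x hx).1 this
    refine ⟨_, s.image e, ⟨?_, ?_, ?_, ?_⟩, ?_, rfl⟩
    · simpa using fun x hx => (h1 x hx).1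
    · simpa using fun x hx => (h1 x hx).2
    · simp only [Finset.mem_image]
      rintro _ ⟨x, hx, rfl⟩ _ ⟨y, hy, rfl⟩ hxy
      exact h2 x hx y hy fun h => hxy (by rw [h])
    · rw [Finset.sum_image fun x hx y hy h => hinj x hx y hy h, h3]
    · rw [← h4]
      exact Submodule.sum_mem _ fun x hx => Submodule.smul_mem _ _
        (Submodule.subset_span (by simpa using ⟨x, hx, rfl⟩))
  -- Take a system of maximal size whose span contains a. Splitting a member as p + q would produce
  -- a larger one.
  obtain ⟨s, hs, has, hcard⟩ := Nat.sSup_mem hne hbdd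
  obtain ⟨c, -, hc⟩ := Submodule.mem_span_finset.1 has
  refine ⟨s, c, hs, fun e he => ⟨hs.ne_zero e he, hs.idem e he, ?_⟩, hc.symm⟩
  rintro p q hp0 hp hq0 hq rfl
  have hpq := H.mul_eq_zero_of_idem_add hp hq (hs.idem _ he)
  have hep : m (p + q) p = p := by rw [map_add, LinearMap.add_apply, hp, H.comm, hpq, add_zero]
  have heq : m (p + q) q = q := by rw [map_add, LinearMap.add_apply, hq, hpq, zero_add]
  have hpf : ∀ f ∈ s.erase (p + q), m p f = 0 ∧ m q f = 0 := fun f hf => by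
    have hf' := Finset.mem_erase.1 hf
    have := hs.orthogonal _ he f hf'.2 hf'.1.symm
    exact ⟨H.one_mul_zero (hs.idem _ he) hep this, H.one_mul_zero (hs.idem _ he) heq this⟩
  have hqs : q ∉ s.erase (p + q) := fun h => hq0 (by rw [← hq, (hpf q h).2])
  have hps : p ∉ insert q (s.erase (p + q)) := fun h => by
    rcases Finset.mem_insert.1 h with h | h
    · exact hp0 (by rw [← hp]; nth_rw 2 [h]; exact hpq)
    · exact hp0 (by rw [← hp, (hpf p h).1])
  have hsum : p + (q + ∑ f ∈ s.erase (p + q), f) = u := by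
    rw [← add_assoc, Finset.add_sum_erase s (fun f => f) he, hs.sum_eq]
  have hmem : s.card + 1 ∈ N := by
    refine ⟨insert p (insert q (s.erase (p + q))), ⟨?_, ?_, ?_, ?_⟩, ?_, ?_⟩
    · simp only [Finset.mem_insert]
      rintro f (rfl | rfl | hf)
      exacts [hp0, hq0, hs.ne_zero f (Finset.mem_of_mem_erase hf)]
    · simp only [Finset.mem_insert]
      rintro f (rfl | rfl | hf)
      exacts [hp, hq, hs.idem f (Finset.mem_of_mem_erase hf)]
    · simp only [Finset.mem_insert]
      rintro f (rfl | rfl | hf) g (rfl | rfl | hg) hfg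
      · exact absurd rfl hfg
      · exact hpq
      · exact (hpf g hg).1
      · rw [H.comm]; exact hpq
      · exact absurd rfl hfg
      · exact (hpf g hg).2
      · rw [H.comm]; exact (hpf f hf).1
      · rw [H.comm]; exact (hpf f hf).2
      · exact hs.orthogonal f (Finset.mem_of_mem_erase hf) g (Finset.mem_of_mem_erase hg) hfg
    · rw [Finset.sum_insert hps, Finset.sum_insert hqs, hsum]
    · refine Submodule.span_le.2 ?_ has
      intro f hf
      by_cases h : f = p + q
      · rw [h]
        exact Submodule.add_mem _ (Submodule.subset_span (by simp))
          (Submodule.subset_span (by simp))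
      · refine Submodule.subset_span ?_
        simp only [Finset.coe_insert, Finset.coe_erase, Set.mem_insert_iff, Set.mem_sdiff,
          Set.mem_singleton_iff]
        exact Or.inr (Or.inr ⟨hf, h⟩)
    · rw [Finset.card_insert_of_notMem hps, Finset.card_insert_of_notMem hqs,
        Finset.card_erase_add_one he]
  have := le_csSup hbdd hmem
  omega

end Frames

end IsFormallyRealJordan

/-! ### Transition functionals of primitive idempotents -/

/-- The linear functional `α` with `P(e) y = α(y) e`, for a primitive idempotent `e`. -/
noncomputable def transition {E : Type*} [AddCommGroup E] [Module ℝ E]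
    (m : E →ₗ[ℝ] E →ₗ[ℝ] E) (e : E) : E →ₗ[ℝ] ℝ :=
  open Classical in
  if h : ∃ α : E →ₗ[ℝ] ℝ, ∀ y, peirceOne m e y = α y • e then h.choose else 0

namespace IsOrthogonalSystem

variable {E : Type*} [AddCommGroup E] [Module ℝ E] {m : E →ₗ[ℝ] E →ₗ[ℝ] E} {u : E}
  {s : Finset E}

theorem mul_self_sum (hs : IsOrthogonalSystem m u s) (c : E → ℝ) :
    m (∑ e ∈ s, c e • e) (∑ e ∈ s, c e • e) = ∑ e ∈ s, (c e ^ 2) • e := by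
  have h : ∀ a, m (∑ e ∈ s, c e • e) a = ∑ e ∈ s, c e • m e a := fun a => by simp
  rw [h]
  exact Finset.sum_congr rfl fun e he => by rw [hs.mul_sum c he, smul_smul, sq]

end IsOrthogonalSystem

namespace IsFormallyRealJordan

variable {E : Type*} [AddCommGroup E] [Module ℝ E] {m : E →ₗ[ℝ] E →ₗ[ℝ] E} {u : E}

section Transition

theorem eq_of_mul_eq (H : IsFormallyRealJordan m u) {e f : E} (he : IsPrimitive m e)
    (hf0 : f ≠ 0) (hf : m f f = f) (hef : m e f = f) : f = e := by
  by_contra hne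
  refine he.indecomposable f (e - f) hf0 hf (sub_ne_zero.2 (Ne.symm hne)) ?_ (by abel)
  simp only [map_sub, LinearMap.sub_apply, he.idem, hf, hef, H.comm f e]
  abel

/-- The Peirce space 1 of e is a subalgebra, so it contains the spectral idempotents of a with
non-zero eigenvalue; by primitivity each of them is e. -/
theorem eq_smul_of_mul_eq [FiniteDimensional ℝ E] (H : IsFormallyRealJordan m u) {e a : E}
    (he : IsPrimitive m e) (ha : m e a = a) : ∃ t : ℝ, a = t • e := by
  obtain ⟨s, p, h1, -, -, h4, h5⟩ := H.exists_spectral a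
  have hW : ∀ x ∈ s, x ≠ 0 → m e (p x) = p x := by
    intro x hx hx0
    have := h5 (LinearMap.ker (m e - LinearMap.id)) (by simp [ha]) (fun b hb => by
      simp only [LinearMap.mem_ker, LinearMap.sub_apply, LinearMap.id_apply, sub_eq_zero] at hb ⊢
      exact H.one_mul_one he.idem ha hb) x hx hx0
    simpa [sub_eq_zero] using this
  refine ⟨∑ x ∈ s, x, ?_⟩
  rw [← h4, Finset.sum_smul]
  refine Finset.sum_congr rfl fun x hx => ?_
  rcases eq_or_ne x 0 with rfl | hx0
  · simp
  · rw [H.eq_of_mul_eq he (h1 x hx).1 (h1 x hx).2 (hW x hx hx0)]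

theorem peirceOne_eq [FiniteDimensional ℝ E] (H : IsFormallyRealJordan m u) {e : E}
    (he : IsPrimitive m e) (y : E) : peirceOne m e y = transition m e y • e := by
  have h : ∃ α : E →ₗ[ℝ] ℝ, ∀ y, peirceOne m e y = α y • e := by
    obtain ⟨φ, hφ⟩ := Module.Projective.exists_dual_ne_zero ℝ he.ne_zero
    refine ⟨(φ e)⁻¹ • (φ ∘ₗ peirceOne m e), fun y => ?_⟩
    obtain ⟨t, ht⟩ := H.eq_smul_of_mul_eq he (H.mul_peirceOne he.idem y)
    simp only [LinearMap.smul_apply, LinearMap.comp_apply]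
    rw [ht, map_smul, smul_eq_mul, smul_eq_mul, mul_comm t, inv_mul_cancel_left₀ hφ]
  rw [transition, dif_pos h]
  exact h.choose_spec y

theorem transition_eq_of_peirceOne [FiniteDimensional ℝ E] (H : IsFormallyRealJordan m u) {e : E}
    (he : IsPrimitive m e) {y : E} {t : ℝ} (h : peirceOne m e y = t • e) :
    transition m e y = t := by
  rw [H.peirceOne_eq he] at h
  exact smul_left_injective ℝ he.ne_zero h

theorem transition_unit [FiniteDimensional ℝ E] (H : IsFormallyRealJordan m u) {e : E}
    (he : IsPrimitive m e) : transition m e u = 1 :=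
  H.transition_eq_of_peirceOne he (by
    rw [peirceOne_apply, H.mul_unit, he.idem]
    module)

/-- Both sides are the coefficient of e in P(e)P(f)e = (P(e)f)². Exchanging e and f as well makes
the squared difference of the two transition numbers vanish. -/
theorem transition_mul_transition [FiniteDimensional ℝ E] (H : IsFormallyRealJordan m u) {e f : E}
    (he : IsPrimitive m e) (hf : IsPrimitive m f) :
    transition m f e * transition m e f = transition m e f * transition m e f := by
  have h := H.peirceOne_quadratic he.idem f
  rw [hf.idem, ← peirceOne_apply, H.peirceOne_eq hf, map_smul, H.peirceOne_eq he] at h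
  simp only [map_smul, LinearMap.smul_apply, he.idem, smul_smul] at h
  exact smul_left_injective ℝ he.ne_zero h

theorem transition_symm [FiniteDimensional ℝ E] (H : IsFormallyRealJordan m u) {e f : E}
    (he : IsPrimitive m e) (hf : IsPrimitive m f) : transition m e f = transition m f e := by
  have h1 := H.transition_mul_transition he hf
  have h2 := H.transition_mul_transition hf he
  have : (transition m e f - transition m f e) ^ 2 = 0 := by linear_combination -h1 - h2
  exact sub_eq_zero.1 (pow_eq_zero_iff two_ne_zero |>.1 this)

end Transition

/-! ### The trace and its associated form -/

section Trace

/-- There is a linear functional with the value one on every primitive idempotent. -/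
theorem exists_trace [FiniteDimensional ℝ E] (H : IsFormallyRealJordan m u) :
    ∃ tr : E →ₗ[ℝ] ℝ, ∀ e, IsPrimitive m e → tr e = 1 := by
  obtain ⟨s, c, hs, hp, -⟩ := H.exists_frame u
  -- By symmetry the value at f is the transition functional of f applied to the sum of the frame,
  -- which is u.
  refine ⟨∑ e ∈ s, transition m e, fun f hf => ?_⟩
  rw [LinearMap.sum_apply, Finset.sum_congr rfl fun e he => H.transition_symm (hp e he) hf,
    ← map_sum, hs.sum_eq, H.transition_unit hf]

variable {tr : E →ₗ[ℝ] ℝ}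

/-- Lets the trace be computed in a frame adapted to a given primitive idempotent. -/
theorem trace_eq_sum_transition [FiniteDimensional ℝ E] (H : IsFormallyRealJordan m u)
    (ht : ∀ e, IsPrimitive m e → tr e = 1) {s : Finset E} (hs : IsOrthogonalSystem m u s)
    (hp : ∀ e ∈ s, IsPrimitive m e) (y : E) : tr y = ∑ e ∈ s, transition m e y := by
  obtain ⟨t, c, -, htp, rfl⟩ := H.exists_frame y
  simp only [map_sum, map_smul]
  rw [Finset.sum_comm]
  refine Finset.sum_congr rfl fun f hf => ?_
  rw [← Finset.smul_sum, Finset.sum_congr rfl fun e he => H.transition_symm (hp e he) (htp f hf),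
    ← map_sum, hs.sum_eq, H.transition_unit (htp f hf), ht f (htp f hf)]

theorem exists_frame_mem [FiniteDimensional ℝ E] (H : IsFormallyRealJordan m u) {e : E}
    (he : IsPrimitive m e) :
    ∃ s : Finset E, IsOrthogonalSystem m u s ∧ (∀ f ∈ s, IsPrimitive m f) ∧ e ∈ s := by
  obtain ⟨s, c, hs, hp, hc⟩ := H.exists_frame e
  refine ⟨s, hs, hp, ?_⟩
  -- As e is idempotent, its coefficients are 0 or 1. A frame member with coefficient 1 lies under
  -- e, so it equals e.
  obtain ⟨f, hf, hf0⟩ : ∃ f ∈ s, c f ≠ 0 := by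
    by_contra! h
    exact he.ne_zero (hc.trans (Finset.sum_eq_zero fun f hf => by rw [h f hf, zero_smul]))
  have h1 : m f e = c f • f := by nth_rw 1 [hc]; exact hs.mul_sum c hf
  have h2 : m f (m e e) = (c f ^ 2) • f := by
    nth_rw 1 2 [hc]
    rw [hs.mul_self_sum, hs.mul_sum (fun f => c f ^ 2) hf]
  rw [he.idem, h1] at h2
  have h3 := smul_left_injective ℝ (hp f hf).ne_zero h2
  have h4 : c f = 1 := by
    have h5 : c f * (c f - 1) = 0 := by linear_combination -h3
    linarith [(mul_eq_zero.1 h5).resolve_left hf0]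
  rw [← H.eq_of_mul_eq he (hp f hf).ne_zero (hp f hf).idem (by rw [H.comm, h1, h4, one_smul])]
  exact hf

/-- In a frame through e, each other member f kills h: P(f)h is a multiple of f, so lies in the
Peirce space 0 of e, yet P(f) preserves the Peirce space 1/2. -/
theorem trace_half [FiniteDimensional ℝ E] (H : IsFormallyRealJordan m u)
    (ht : ∀ e, IsPrimitive m e → tr e = 1) {e h : E} (he : IsPrimitive m e)
    (hh : m e h = (1 / 2 : ℝ) • h) : tr h = 0 := by
  obtain ⟨s, hs, hp, hes⟩ := H.exists_frame_mem he
  rw [H.trace_eq_sum_transition ht hs hp]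
  refine Finset.sum_eq_zero fun f hf => ?_
  rcases eq_or_ne e f with rfl | hef
  · exact H.transition_eq_of_peirceOne he (by rw [peirceOne_of_half hh, zero_smul])
  · have h0 := hs.orthogonal e hes f hf hef
    have h1 := H.zero_mul_half he.idem h0 hh
    have h2 := H.zero_mul_half he.idem h0 h1
    have h3 : m e (peirceOne m f h) = (1 / 2 : ℝ) • peirceOne m f h := by
      rw [peirceOne_apply, map_sub, map_smul, h1, h2]
      module
    rw [H.peirceOne_eq (hp f hf), map_smul, h0, smul_zero, smul_smul] at h3
    have h4 := (smul_eq_zero.1 h3.symm).resolve_right (hp f hf).ne_zero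
    linarith

/-- Mixed products of Peirce components vanish or have trace zero. The right side is symmetric in x
and y, so L(e) is self-adjoint; it is also a sum of traces of squares when x = y. -/
theorem trace_mul_mul_eq [FiniteDimensional ℝ E] (H : IsFormallyRealJordan m u)
    (ht : ∀ e, IsPrimitive m e → tr e = 1) {e : E} (he : IsPrimitive m e) (x y : E) :
    tr (m (m e x) y) = tr (m (peirceOne m e x) (peirceOne m e y))
      + 1 / 2 * tr (m (peirceHalf m e x) (peirceHalf m e y)) := by
  obtain ⟨x₁, hx, x₀, e1, e2, e3, h1, h2, h3, hxx⟩ : ∃ x₁ h x₀, peirceOne m e x = x₁ ∧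
      peirceHalf m e x = h ∧ peirceZero m e x = x₀ ∧ m e x₁ = x₁ ∧ m e h = (1 / 2 : ℝ) • h ∧
      m e x₀ = 0 ∧ x₁ + h + x₀ = x :=
    ⟨_, _, _, rfl, rfl, rfl, H.mul_peirceOne he.idem x, H.mul_peirceHalf he.idem x,
      H.mul_peirceZero he.idem x, peirce_sum e x⟩
  obtain ⟨y₁, hy, y₀, f1, f2, f3, k1, k2, k3, hyy⟩ : ∃ x₁ h x₀, peirceOne m e y = x₁ ∧
      peirceHalf m e y = h ∧ peirceZero m e y = x₀ ∧ m e x₁ = x₁ ∧ m e h = (1 / 2 : ℝ) • h ∧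
      m e x₀ = 0 ∧ x₁ + h + x₀ = y :=
    ⟨_, _, _, rfl, rfl, rfl, H.mul_peirceOne he.idem y, H.mul_peirceHalf he.idem y,
      H.mul_peirceZero he.idem y, peirce_sum e y⟩
  have hex : m e x = x₁ + (1 / 2 : ℝ) • hx := by
    rw [← hxx, map_add, map_add, h1, h2, h3, add_zero]
  have a1 := H.trace_half ht he (H.one_mul_half he.idem h1 k2)
  have a2 := H.one_mul_zero he.idem h1 k3
  have a3 := H.trace_half ht he (H.one_mul_half he.idem k1 h2)
  have a4 := H.trace_half ht he (H.zero_mul_half he.idem k3 h2)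
  rw [e1, e2, f1, f2, hex, ← hyy]
  simp only [map_add, map_smul, LinearMap.add_apply, LinearMap.smul_apply, H.comm hx y₁,
    H.comm hx y₀, a1, a2, a3, a4, map_zero, smul_eq_mul]
  ring

theorem trace_mul_assoc [FiniteDimensional ℝ E] (H : IsFormallyRealJordan m u)
    (ht : ∀ e, IsPrimitive m e → tr e = 1) {e : E} (he : IsPrimitive m e) (x y : E) :
    tr (m (m e x) y) = tr (m x (m e y)) := by
  rw [H.comm x, H.trace_mul_mul_eq ht he, H.trace_mul_mul_eq ht he, H.comm (peirceOne m e x),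
    H.comm (peirceHalf m e x)]

theorem trace_mul_self_nonneg [FiniteDimensional ℝ E] (H : IsFormallyRealJordan m u)
    (ht : ∀ e, IsPrimitive m e → tr e = 1) (a : E) : 0 ≤ tr (m a a) := by
  obtain ⟨s, c, hs, hp, rfl⟩ := H.exists_frame a
  rw [hs.mul_self_sum, map_sum]
  refine Finset.sum_nonneg fun e he => ?_
  rw [map_smul, ht e (hp e he), smul_eq_mul, mul_one]
  positivity

theorem trace_mul_self_pos [FiniteDimensional ℝ E] (H : IsFormallyRealJordan m u)
    (ht : ∀ e, IsPrimitive m e → tr e = 1) {a : E} (ha : a ≠ 0) : 0 < tr (m a a) := by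
  refine (H.trace_mul_self_nonneg ht a).lt_of_ne' fun h => ha ?_
  obtain ⟨s, c, hs, hp, rfl⟩ := H.exists_frame a
  rw [hs.mul_self_sum, map_sum, Finset.sum_eq_zero_iff_of_nonneg fun e he => by
    rw [map_smul, ht e (hp e he), smul_eq_mul, mul_one]; positivity] at h
  refine Finset.sum_eq_zero fun e he => ?_
  have := h e he
  rw [map_smul, ht e (hp e he), smul_eq_mul, mul_one, pow_eq_zero_iff two_ne_zero] at this
  rw [this, zero_smul]

theorem trace_mul_nonneg_of_primitive [FiniteDimensional ℝ E] (H : IsFormallyRealJordan m u)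
    (ht : ∀ e, IsPrimitive m e → tr e = 1) {e f : E} (he : IsPrimitive m e)
    (hf : IsPrimitive m f) : 0 ≤ tr (m e f) := by
  have h : tr (m e f) = tr (m (m f e) e) := by
    rw [H.comm f e, H.trace_mul_assoc ht he, he.idem, H.comm]
  rw [h, H.trace_mul_mul_eq ht hf]
  have h1 := H.trace_mul_self_nonneg ht (peirceOne m f e)
  have h2 := H.trace_mul_self_nonneg ht (peirceHalf m f e)
  positivity

/-- Squares have non-negative eigenvalues. -/
theorem exists_frame_of_square [FiniteDimensional ℝ E] (H : IsFormallyRealJordan m u) (b : E) :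
    ∃ (s : Finset E) (c : E → ℝ), IsOrthogonalSystem m u s ∧ (∀ e ∈ s, IsPrimitive m e) ∧
      (∀ e ∈ s, 0 ≤ c e) ∧ m b b = ∑ e ∈ s, c e • e := by
  obtain ⟨s, c, hs, hp, rfl⟩ := H.exists_frame b
  exact ⟨s, fun e => c e ^ 2, hs, hp, fun e _ => sq_nonneg _, hs.mul_self_sum c⟩

theorem trace_square_mul_square_nonneg [FiniteDimensional ℝ E] (H : IsFormallyRealJordan m u)
    (ht : ∀ e, IsPrimitive m e → tr e = 1) (a b : E) : 0 ≤ tr (m (m a a) (m b b)) := by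
  obtain ⟨s, c, -, hp, hc, ha⟩ := H.exists_frame_of_square a
  obtain ⟨t, d, -, hq, hd, hb⟩ := H.exists_frame_of_square b
  rw [ha, hb]
  simp only [map_sum, map_smul, LinearMap.sum_apply, LinearMap.smul_apply, smul_eq_mul]
  exact Finset.sum_nonneg fun f hf => mul_nonneg (hd f hf) <| Finset.sum_nonneg fun e he =>
    mul_nonneg (hc e he) (H.trace_mul_nonneg_of_primitive ht (hp e he) (hq f hf))

theorem exists_square_iff [FiniteDimensional ℝ E] (H : IsFormallyRealJordan m u)
    (ht : ∀ e, IsPrimitive m e → tr e = 1) (a : E) :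
    (∃ b, m b b = a) ↔ ∀ b, 0 ≤ tr (m a (m b b)) := by
  constructor
  · rintro ⟨b, rfl⟩ c
    exact H.trace_square_mul_square_nonneg ht b c
  · intro h
    -- Testing against the frame members shows that the eigenvalues are non-negative, so a square
    -- root exists.
    obtain ⟨s, c, hs, hp, rfl⟩ := H.exists_frame a
    refine ⟨∑ e ∈ s, Real.sqrt (c e) • e, ?_⟩
    rw [hs.mul_self_sum]
    refine Finset.sum_congr rfl fun e he => ?_
    have h1 := h e
    rw [(hp e he).idem, H.comm, hs.mul_sum c he, map_smul, ht e (hp e he), smul_eq_mul,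
      mul_one] at h1
    rw [Real.sq_sqrt h1]

theorem trace_square_le [FiniteDimensional ℝ E] (H : IsFormallyRealJordan m u)
    (ht : ∀ e, IsPrimitive m e → tr e = 1) (b : E) :
    tr (m (m b b) (m b b)) ≤ tr (m b b) ^ 2 := by
  obtain ⟨s, c, hs, hp, hc, hb⟩ := H.exists_frame_of_square b
  have h : ∀ d : E → ℝ, tr (∑ e ∈ s, d e • e) = ∑ e ∈ s, d e := fun d => by
    rw [map_sum]
    exact Finset.sum_congr rfl fun e he => by
      rw [map_smul, ht e (hp e he), smul_eq_mul, mul_one]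
  rw [hb, hs.mul_self_sum, h, h]
  exact Finset.sum_sq_le_sq_sum_of_nonneg hc

end Trace

end IsFormallyRealJordan

/-! ### Trace form and pure states of a Jordan model -/

namespace ProbModel

section Jordan

variable {E : Type*} [AddCommGroup E] [Module ℝ E] [PartialOrder E] {A : ProbModel E}

theorem IsEuclideanJordanProduct.isFormallyRealJordan {m : E →ₗ[ℝ] E →ₗ[ℝ] E}
    (h : A.IsEuclideanJordanProduct m) : IsFormallyRealJordan m A.unit :=
  ⟨h.comm, h.jordan, h.unit_mul, h.formally_real⟩

/-- A Jordan model has a Euclidean Jordan product: either it has an outcome, which is an idempotent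
of this product, or its space is trivial. -/
theorem IsJordanModel.isEuclideanJordanProduct [TopologicalSpace E] (hA : A.IsJordanModel) :
    A.IsEuclideanJordanProduct A.jordanProduct := by
  by_cases h : ∃ m, A.IsEuclideanJordanProduct m
  · rw [jordanProduct, dif_pos h]
    exact h.choose_spec
  -- With the default product 0 there are no idempotents, hence no outcomes, and the cone is {0}.
  -- Self-duality then forces E = 0, where 0 is a Euclidean Jordan product after all.
  · exfalso
    have h0 : A.jordanProduct = 0 := dif_neg h
    have hout : {x : E | ∃ T ∈ A.tests, x ∈ T} = ∅ := by
      refine Set.eq_empty_of_forall_notMem fun x hx => ?_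
      have := (hA.2 x hx).1
      exact this.1 (by rw [← this.2.2, h0]; rfl)
    have hpos : ∀ a : E, 0 ≤ a → a = 0 := fun a ha => by
      have := A.nonneg_mem_span a ha
      rwa [hout, Submodule.span_empty, Submodule.mem_bot] at this
    obtain ⟨f, hf⟩ := hA.1.2
    have hf0 : ∀ a, f a 0 = 0 := fun a => by
      have := hf.smul_left 0 0 a
      rwa [zero_smul, zero_mul, hf.symm] at this
    have : Subsingleton E := subsingleton_of_forall_eq 0 fun a =>
      hpos a ((hf.self_dual a).2 fun b hb => by rw [hpos b hb, hf0])
    exact h ⟨0, fun _ _ => rfl, fun _ _ => Subsingleton.elim _ _, fun _ => Subsingleton.elim _ _,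
      fun _ _ _ => ⟨Subsingleton.elim _ _, Subsingleton.elim _ _⟩, fun a =>
        ⟨fun _ => ⟨0, Subsingleton.elim _ _⟩, fun _ => (Subsingleton.elim 0 a).le⟩⟩

theorem isIdempotent_iff (hJ : A.IsEuclideanJordanProduct A.jordanProduct) {p : E} :
    A.IsIdempotent p ↔ p ≠ 0 ∧ A.jordanProduct p p = p :=
  ⟨fun h => ⟨h.1, h.2.2⟩, fun h => ⟨h.1, (hJ.nonneg_iff_square p).2 ⟨p, h.2⟩, h.2⟩⟩

theorem isPrimitiveIdempotent_iff (hJ : A.IsEuclideanJordanProduct A.jordanProduct) {e : E} :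
    A.IsPrimitiveIdempotent e ↔ IsPrimitive A.jordanProduct e := by
  constructor
  · rintro ⟨h1, h2⟩
    refine ⟨h1.1, h1.2.2, fun p q hp0 hp hq0 hq h => h2 ⟨p, q, ?_, (isIdempotent_iff hJ).2 ⟨hp0, hp⟩,
      (isIdempotent_iff hJ).2 ⟨hq0, hq⟩, h⟩⟩
    -- Distinctness is automatic: two idempotents with idempotent sum are orthogonal, so p = q would
    -- give p = p² = 0.
    rintro rfl
    have h3 := hJ.isFormallyRealJordan.mul_eq_zero_of_idem_add hp hp (by rw [← h]; exact h1.2.2)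
    exact hp0 (by rw [← hp, h3])
  · intro h
    refine ⟨(isIdempotent_iff hJ).2 ⟨h.ne_zero, h.idem⟩, ?_⟩
    rintro ⟨p, q, -, hp, hq, rfl⟩
    exact h.indecomposable p q hp.1 hp.2.2 hq.1 hq.2.2 rfl

/-- Linearity of `tr` makes the coefficient sum independent of the decomposition chosen in
`jordanTrace`. -/
theorem jordanTrace_eq [FiniteDimensional ℝ E] (hJ : A.IsEuclideanJordanProduct A.jordanProduct)
    {tr : E →ₗ[ℝ] ℝ} (ht : ∀ e, IsPrimitive A.jordanProduct e → tr e = 1) (a : E) :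
    A.jordanTrace a = tr a := by
  have h : ∃ d : Finset E × (E → ℝ), A.IsSpectralDecomposition a d := by
    obtain ⟨s, c, hs, hp, hc⟩ := hJ.isFormallyRealJordan.exists_frame a
    exact ⟨(s, c), ⟨fun e he => (isPrimitiveIdempotent_iff hJ).2 (hp e he), hs.sum_eq⟩, hc⟩
  rw [jordanTrace, dif_pos h]
  have hd := h.choose_spec
  conv_rhs => rw [hd.2]
  rw [map_sum]
  refine Finset.sum_congr rfl fun e he => ?_
  rw [map_smul, ht e ((isPrimitiveIdempotent_iff hJ).1 (hd.1.1 e he)), smul_eq_mul, mul_one]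

theorem nonneg_induction {P : E → Prop} (hout : ∀ x ∈ A.outcomes, P x) (hzero : P 0)
    (hadd : ∀ a b, P a → P b → P (a + b)) (hsmul : ∀ (t : ℝ) a, 0 ≤ t → P a → P (t • a))
    {a : E} (ha : 0 ≤ a) : P a :=
  Submodule.span_induction (p := fun a _ => P a) hout hzero (fun a b _ _ => hadd a b)
    (fun (t : {t : ℝ // 0 ≤ t}) a _ h => hsmul t.1 a t.2 h) (A.nonneg_mem_span a ha)

/-- Linear maps on a Jordan model are determined by their values on outcomes. -/
theorem IsJordanModel.ext_outcomes [FiniteDimensional ℝ E] [TopologicalSpace E]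
    (hA : A.IsJordanModel) {V : Type*} [AddCommGroup V] [Module ℝ V] {φ ψ : E →ₗ[ℝ] V}
    (h : ∀ x ∈ A.outcomes, φ x = ψ x) : φ = ψ := by
  have hJ := hA.isEuclideanJordanProduct
  have hpos : ∀ a : E, 0 ≤ a → φ a = ψ a := fun a ha =>
    nonneg_induction (P := fun a => φ a = ψ a) h (by simp) (fun a b h1 h2 => by simp [h1, h2])
      (fun t a _ h1 => by simp [h1]) ha
  ext a
  obtain ⟨s, c, hs, -, rfl⟩ := hJ.isFormallyRealJordan.exists_frame a
  simp only [map_sum, map_smul]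
  exact Finset.sum_congr rfl fun e he => by
    rw [hpos e ((hJ.nonneg_iff_square e).2 ⟨e, hs.idem e he⟩)]

/-- The properties of the trace form of a Jordan model that determine the pure states. -/
structure IsPureForm (A : ProbModel E) (B : E →ₗ[ℝ] E →ₗ[ℝ] ℝ) : Prop where
  selfDual : IsSelfDualizing fun a b => B a b
  outcome_self : ∀ x ∈ A.outcomes, B x x = 1
  outcome_unit : ∀ x ∈ A.outcomes, B x A.unit = 1
  le_sq : ∀ v : E, 0 ≤ v → B v v ≤ B v A.unit ^ 2

theorem IsJordanModel.exists_isPureForm [FiniteDimensional ℝ E] [TopologicalSpace E]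
    (hA : A.IsJordanModel) :
    ∃ B : E →ₗ[ℝ] E →ₗ[ℝ] ℝ, (A.traceForm = fun a b => B a b) ∧ A.IsPureForm B := by
  have hJ := hA.isEuclideanJordanProduct
  have H := hJ.isFormallyRealJordan
  obtain ⟨tr, ht⟩ := H.exists_trace
  have hprim : ∀ x ∈ A.outcomes, IsPrimitive A.jordanProduct x := fun x hx =>
    (isPrimitiveIdempotent_iff hJ).1 (hA.2 x hx)
  refine ⟨A.jordanProduct.compr₂ tr, funext₂ fun a b => jordanTrace_eq hJ ht _, ⟨?_, ?_, ?_, ?_, ?_⟩,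
    fun x hx => ?_, fun x hx => ?_, fun v hv => ?_⟩
  · intro a b c; simp
  · intro t a b; simp
  · intro a b; simp [H.comm a b]
  · intro a ha; exact H.trace_mul_self_pos ht ha
  · intro a
    rw [hJ.nonneg_iff_square, H.exists_square_iff ht]
    refine ⟨fun h b hb => ?_, fun h b => h _ ((hJ.nonneg_iff_square _).2 ⟨b, rfl⟩)⟩
    obtain ⟨c, rfl⟩ := (hJ.nonneg_iff_square b).1 hb
    exact h c
  · rw [LinearMap.compr₂_apply, (hprim x hx).idem, ht x (hprim x hx)]
  · rw [LinearMap.compr₂_apply, H.mul_unit, ht x (hprim x hx)]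
  · obtain ⟨b, rfl⟩ := (hJ.nonneg_iff_square v).1 hv
    rw [LinearMap.compr₂_apply, LinearMap.compr₂_apply, H.mul_unit]
    exact H.trace_square_le ht b

theorem unit_sub_outcome_nonneg [IsOrderedAddMonoid E] {x : E} (hx : x ∈ A.outcomes) :
    0 ≤ A.unit - x := by
  obtain ⟨T, hT, hxT⟩ := hx
  rw [sub_nonneg, ← A.test_sum T hT]
  exact Finset.single_le_sum (f := fun x => x) (fun y hy => A.test_nonneg T hT y hy) hxT

theorem outcome_nonneg {x : E} (hx : x ∈ A.outcomes) : 0 ≤ x := by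
  obtain ⟨T, hT, hxT⟩ := hx
  exact A.test_nonneg T hT x hxT

namespace IsPureForm

variable {B : E →ₗ[ℝ] E →ₗ[ℝ] ℝ}

theorem nonneg (hB : A.IsPureForm B) {a b : E} (ha : 0 ≤ a) (hb : 0 ≤ b) : 0 ≤ B a b :=
  (hB.selfDual.self_dual a).1 ha b hb

theorem eq_zero_of_nonpos (hB : A.IsPureForm B) {a : E} (h : B a a ≤ 0) : a = 0 := by
  by_contra h0
  exact absurd (hB.selfDual.pos a h0) (not_lt.2 h)

theorem exists_eq [FiniteDimensional ℝ E] (hB : A.IsPureForm B) (φ : E →ₗ[ℝ] ℝ) :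
    ∃ w, B w = φ := by
  have hinj : Function.Injective B := by
    rw [← LinearMap.ker_eq_bot, LinearMap.ker_eq_bot']
    exact fun a ha => hB.eq_zero_of_nonpos (by rw [ha]; rfl)
  exact (LinearMap.injective_iff_surjective_of_finrank_eq_finrank
    (Subspace.dual_finrank_eq (K := ℝ) (V := E)).symm).1 hinj φ

/-- The state defined by an outcome spans an extreme ray: it is, up to a factor, the only positive
functional that takes the same value at the outcome and at the unit. -/
theorem apply_eq [FiniteDimensional ℝ E] (hB : A.IsPureForm B) {φ : E →ₗ[ℝ] ℝ}
    (hφ : ∀ a, 0 ≤ a → 0 ≤ φ a) {x : E} (hx : x ∈ A.outcomes) (h : φ x = φ A.unit) (a : E) :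
    φ a = φ A.unit * B x a := by
  obtain ⟨w, rfl⟩ := hB.exists_eq φ
  have hw : 0 ≤ w := (hB.selfDual.self_dual w).2 hφ
  -- With t = ⟨w, u⟩ = ⟨w, x⟩, the squared norm of w - tx is ⟨w, w⟩ - t², which `le_sq` makes
  -- non-positive.
  have h0 : w - B w A.unit • x = 0 := by
    refine hB.eq_zero_of_nonpos ?_
    have h1 := hB.le_sq w hw
    have h2 : B x w = B w x := hB.selfDual.symm x w
    simp only [map_sub, map_smul, LinearMap.sub_apply, LinearMap.smul_apply, smul_eq_mul,
      hB.outcome_self x hx, h2, h]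
    linarith
  rw [sub_eq_zero] at h0
  nth_rw 1 [h0]
  simp

theorem outcome_le_one [IsOrderedAddMonoid E] (hB : A.IsPureForm B) {x y : E}
    (hx : x ∈ A.outcomes) (hy : y ∈ A.outcomes) : B x y ≤ 1 := by
  have := hB.nonneg (outcome_nonneg hx) (unit_sub_outcome_nonneg hy)
  rw [map_sub, hB.outcome_unit x hx] at this
  linarith

theorem outcome_eq (hB : A.IsPureForm B) {x y : E}
    (hx : x ∈ A.outcomes) (hy : y ∈ A.outcomes) (h : B x y = 1) : x = y := by
  refine sub_eq_zero.1 (hB.eq_zero_of_nonpos ?_)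
  have h2 : B y x = B x y := hB.selfDual.symm y x
  simp only [map_sub, LinearMap.sub_apply, hB.outcome_self x hx, hB.outcome_self y hy, h2, h]
  norm_num

theorem isState (hB : A.IsPureForm B) {x : E} (hx : x ∈ A.outcomes) : A.IsState (B x) :=
  ⟨fun _ ha => hB.nonneg (outcome_nonneg hx) ha, hB.outcome_unit x hx⟩

end IsPureForm

end Jordan

end ProbModel

/-! ### Factorization on the composite -/

namespace NonSignalingComposite

open ProbModel

variable {E F G : Type*} [AddCommGroup E] [Module ℝ E] [PartialOrder E]
  [AddCommGroup F] [Module ℝ F] [PartialOrder F] [AddCommGroup G] [Module ℝ G] [PartialOrder G]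
  {A : ProbModel E} {B : ProbModel F} {AB : ProbModel G}

theorem tensor_mem_outcomes (C : NonSignalingComposite A B AB) {x : E} {y : F}
    (hx : x ∈ A.outcomes) (hy : y ∈ B.outcomes) : C.tensor x y ∈ AB.outcomes := by
  classical
  obtain ⟨S, hS, hxS⟩ := hx
  obtain ⟨T, hT, hyT⟩ := hy
  exact ⟨_, C.product_test S hS T hT, Finset.mem_image₂_of_mem hxS hyT⟩

theorem tensor_nonneg [IsOrderedAddMonoid G] [PosSMulMono ℝ G] (C : NonSignalingComposite A B AB)
    {a : E} {b : F} (ha : 0 ≤ a) (hb : 0 ≤ b) : 0 ≤ C.tensor a b := by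
  refine nonneg_induction (A := A) (P := fun a => 0 ≤ C.tensor a b) (fun x hx => ?_) (by simp)
    (fun a a' h h' => by simpa using add_nonneg h h')
    (fun t a ht h => by simpa using smul_nonneg ht h) ha
  refine nonneg_induction (A := B) (P := fun b => 0 ≤ C.tensor x b)
    (fun y hy => outcome_nonneg (C.tensor_mem_outcomes hx hy)) (by simp)
    (fun a a' h h' => by simpa using add_nonneg h h')
    (fun t a ht h => by simpa using smul_nonneg ht h) hb

variable {f : E →ₗ[ℝ] E →ₗ[ℝ] ℝ} {g : F →ₗ[ℝ] F →ₗ[ℝ] ℝ} {h : G →ₗ[ℝ] G →ₗ[ℝ] ℝ}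

/-- The product of the states ⟨x, ·⟩ and ⟨y, ·⟩ has value 1 at x ⊗ y, so ⟨x, x'⟩⟨y, y'⟩ = 1 with
both factors in [0, 1]; both equal 1. -/
theorem tensor_injective [IsOrderedAddMonoid E] [IsOrderedAddMonoid F]
    (C : NonSignalingComposite A B AB) (hf : A.IsPureForm f) (hg : B.IsPureForm g)
    {x x' : E} {y y' : F} (hx : x ∈ A.outcomes) (hx' : x' ∈ A.outcomes) (hy : y ∈ B.outcomes)
    (hy' : y' ∈ B.outcomes) (heq : C.tensor x y = C.tensor x' y') : x = x' ∧ y = y' := by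
  have h1 := C.product_apply _ _ (hf.isState hx) (hg.isState hy) x hx y hy
  rw [heq, C.product_apply _ _ (hf.isState hx) (hg.isState hy) x' hx' y' hy',
    hf.outcome_self x hx, hg.outcome_self y hy] at h1
  have h2 := hf.outcome_le_one hx hx'
  have h3 := hg.outcome_le_one hy hy'
  have h4 := hf.nonneg (outcome_nonneg hx) (outcome_nonneg hx')
  have h5 := hg.nonneg (outcome_nonneg hy) (outcome_nonneg hy')
  exact ⟨hf.outcome_eq hx hx' (by nlinarith), hg.outcome_eq hy hy' (by nlinarith)⟩

/-- A product test is a set, so injectivity of ⊗ on outcomes is needed for its sum to count every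
pair once. -/
theorem tensor_unit [IsOrderedAddMonoid E] [IsOrderedAddMonoid F]
    (C : NonSignalingComposite A B AB) (hf : A.IsPureForm f) (hg : B.IsPureForm g)
    {x : E} {y : F} (hx : x ∈ A.outcomes) (hy : y ∈ B.outcomes) :
    C.tensor A.unit B.unit = AB.unit := by
  classical
  obtain ⟨S, hS, -⟩ := hx
  obtain ⟨T, hT, -⟩ := hy
  have h1 := AB.test_sum _ (C.product_test S hS T hT)
  rw [← h1, ← A.test_sum S hS, ← B.test_sum T hT, Finset.image₂, Finset.sum_image,
    Finset.sum_product]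
  · simp only [map_sum, LinearMap.sum_apply, Function.uncurry]
    exact Finset.sum_comm
  · rintro ⟨x, y⟩ hxy ⟨x', y'⟩ hxy' heq
    simp only [Finset.coe_product, Set.mem_prod, Finset.mem_coe] at hxy hxy'
    obtain ⟨rfl, rfl⟩ := C.tensor_injective hf hg ⟨S, hS, hxy.1⟩ ⟨S, hS, hxy'.1⟩ ⟨T, hT, hxy.2⟩
      ⟨T, hT, hxy'.2⟩ heq
    rfl

theorem form_tensor_outcomes [FiniteDimensional ℝ E] [IsOrderedAddMonoid E]
    [FiniteDimensional ℝ F] [IsOrderedAddMonoid F] [IsOrderedAddMonoid G] [PosSMulMono ℝ G]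
    (C : NonSignalingComposite A B AB)
    (hf : A.IsPureForm f) (hg : B.IsPureForm g) (hh : AB.IsPureForm h)
    {x : E} {y b : F} (hx : x ∈ A.outcomes) (hy : y ∈ B.outcomes) (hb : b ∈ B.outcomes) (a : E) :
    h (C.tensor x y) (C.tensor a b) = f x a * g y b := by
  have hxy := C.tensor_mem_outcomes hx hy
  let ω : E →ₗ[ℝ] F →ₗ[ℝ] ℝ := C.tensor.compr₂ (h (C.tensor x y))
  have hω : ∀ a b, ω a b = h (C.tensor x y) (C.tensor a b) := fun a b => rfl
  have hpos : ∀ {a b}, 0 ≤ a → 0 ≤ b → 0 ≤ ω a b := fun ha hb =>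
    hh.nonneg (outcome_nonneg hxy) (C.tensor_nonneg ha hb)
  have huu : ω A.unit B.unit = 1 := by
    rw [hω, C.tensor_unit hf hg hx hy, hh.outcome_unit _ hxy]
  have h1 : ω x y = 1 := hh.outcome_self _ hxy
  have x0 := outcome_nonneg hx
  have x1 := unit_sub_outcome_nonneg hx
  have y0 := outcome_nonneg hy
  have y1 := unit_sub_outcome_nonneg hy
  have b0 := outcome_nonneg hb
  have b1 := unit_sub_outcome_nonneg hb
  have hxu := hpos x0 y1
  have huy := hpos x1 y0
  have huy' := hpos A.unit_nonneg y1
  have hxb := hpos x1 b0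
  have hxb' := hpos x1 b1
  simp only [map_sub, LinearMap.sub_apply, huu, h1] at hxu huy huy' hxb hxb'
  -- From 1 = ω(x, y) ≤ ω(u, y) ≤ ω(u, u) = 1, the marginal ω(u, ·) is the pure state of y.
  have hub : ω A.unit b = g y b := by
    rw [hg.apply_eq (φ := ω A.unit) (fun b hb => hpos A.unit_nonneg hb) hy (by linarith), huu,
      one_mul]
  -- Here ω(u - x, b) and ω(u - x, u - b) are non-negative with sum 1 - ω(x, u) ≤ 0, so ω(x, b) =
  -- ω(u, b).
  have := hf.apply_eq (φ := ω.flip b) (fun a ha => hpos ha b0) hx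
    (by simp only [LinearMap.flip_apply]; linarith) a
  simp only [LinearMap.flip_apply, hub] at this
  rw [← hω, this, mul_comm]

theorem form_tensor [FiniteDimensional ℝ E] [TopologicalSpace E] [IsOrderedAddMonoid E]
    [FiniteDimensional ℝ F] [TopologicalSpace F] [IsOrderedAddMonoid F]
    [IsOrderedAddMonoid G] [PosSMulMono ℝ G]
    (C : NonSignalingComposite A B AB) (hA : A.IsJordanModel) (hB : B.IsJordanModel)
    (hf : A.IsPureForm f) (hg : B.IsPureForm g) (hh : AB.IsPureForm h) (a c : E) (b d : F) :
    h (C.tensor a b) (C.tensor c d) = f a c * g b d := by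
  have h1 : ∀ x ∈ A.outcomes, ∀ y ∈ B.outcomes,
      h (C.tensor x y) (C.tensor c d) = f x c * g y d := fun x hx y hy => by
    have : h (C.tensor x y) ∘ₗ C.tensor c = f x c • g y :=
      hB.ext_outcomes fun b hb => C.form_tensor_outcomes hf hg hh hx hy hb c
    exact LinearMap.congr_fun this d
  have h2 : ∀ y ∈ B.outcomes, h (C.tensor a y) (C.tensor c d) = f a c * g y d := fun y hy => by
    have : h.flip (C.tensor c d) ∘ₗ C.tensor.flip y = g y d • f.flip c :=
      hA.ext_outcomes fun x hx => (h1 x hx y hy).trans (mul_comm _ _)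
    exact (LinearMap.congr_fun this a).trans (mul_comm _ _)
  have : h.flip (C.tensor c d) ∘ₗ C.tensor a = f a c • g.flip d :=
    hB.ext_outcomes fun y hy => h2 y hy
  exact LinearMap.congr_fun this b

end NonSignalingComposite

theorem mainTheorem6
    {E F G : Type*}
    [AddCommGroup E] [Module ℝ E] [FiniteDimensional ℝ E]
    [PartialOrder E] [IsOrderedAddMonoid E] [PosSMulMono ℝ E]
    [TopologicalSpace E] [IsTopologicalAddGroup E] [ContinuousSMul ℝ E] [T2Space E]
    [AddCommGroup F] [Module ℝ F] [FiniteDimensional ℝ F]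
    [PartialOrder F] [IsOrderedAddMonoid F] [PosSMulMono ℝ F]
    [TopologicalSpace F] [IsTopologicalAddGroup F] [ContinuousSMul ℝ F] [T2Space F]
    [AddCommGroup G] [Module ℝ G] [FiniteDimensional ℝ G]
    [PartialOrder G] [IsOrderedAddMonoid G] [PosSMulMono ℝ G]
    [TopologicalSpace G] [IsTopologicalAddGroup G] [ContinuousSMul ℝ G] [T2Space G]
    (A : ProbModel E) (B : ProbModel F) (AB : ProbModel G)
    (hA : A.IsJordanModel) (hB : B.IsJordanModel)
    (C : NonSignalingComposite A B AB) (hAB : AB.IsJordanModel) :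
    (∀ (a c : E) (b d : F),
      AB.traceForm (C.tensor a b) (C.tensor c d) = A.traceForm a c * B.traceForm b d) ∧
    IsSelfDualizing AB.traceForm ∧
    C.Factors A.traceForm B.traceForm AB.traceForm ∧
    C.IsFactorizablySelfDual := by
  obtain ⟨f, hf, hf'⟩ := hA.exists_isPureForm
  obtain ⟨g, hg, hg'⟩ := hB.exists_isPureForm
  obtain ⟨h, hh, hh'⟩ := hAB.exists_isPureForm
  have hfac : C.Factors A.traceForm B.traceForm AB.traceForm := by
    rw [hf, hg, hh]
    exact ⟨hf'.selfDual, hg'.selfDual, C.form_tensor hA hB hf' hg' hh'⟩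
  have hsd : IsSelfDualizing AB.traceForm := hh ▸ hh'.selfDual
  exact ⟨hfac.2.2, hsd, hfac, _, _, _, hsd, hfac⟩
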